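/- **Words and tableaux.** Let $n\ge 0$. A standard word of length $n$ is a word $w=w_1\cdots w_n$ in which each of $1,\dots,n$ occurs exactly once. $P(w)$ denotes its insertion tableau, obtained by Schensted row insertion of $w_1,\dots,w_n$ in this order (English notation), and $\mathrm{rowword}(T)$ is the row reading word of a tableau $T$ (rows read from south to north, each from west to east). **Catabolizability.** If the first row of $T$ has at least $m$ entries, let $T_{(m)}$ be the subtableau formed by its first $m$ entries, and let $\mathrm{Cat}_m(T)$ be the insertion tableau of the word consisting of the remaining entries of the first row (from west to east) followed by the row reading word of the tableau formed by the second and all lower rows of $T$. For a partition $\lambda=(\lambda_1,\hat\lambda)$ of $|T|$, $T$ is $\lambda$-catabolizable if its first row has at least $\lambda_1$ entries, $T_{(\lambda_1)}$ contains the $\lambda_1$ smallest entries of $T$, and $\mathrm{Cat}_{\lambda_1}(T)$ is $\hat\lambda$-catabolizable; the empty tableau is $\varnothing$-catabolizable. **Cocharge labeling.** The cocharge labeling of a standard word $w$ is the word obtained by replacing each number of $w$ by its label, where $1$ has label $0$ and, if $i$ has label $k$, then $i+1$ has label $k$ if it stands to the right of $i$ in $w$, and $k+1$ if it stands to the left of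 $i$. **Algorithm.** The input is a standard word $w$ of length $n$ and a partition $\lambda$ of $n$ (with $\lambda_i=0$ for $i>\ell(\lambda)$). For a word $ya$ with last letter $a$ and a partition $\nu$, put $$f_\lambda(ya,\nu)=\begin{cases}(y,\ \nu+\epsilon_{a+1}) & \text{if } \nu+\epsilon_{a+1}\text{ is a partition and }\nu_{a+1}+1\le\lambda_{a+1},\\ ((a+1)\,y,\ \nu) & \text{otherwise,}\end{cases}$$ where $\epsilon_i$ is the $i$-th standard basis vector. Start with the pair (cocharge labeling of $w$, $\varnothing$) and apply $f_\lambda$ repeatedly, until either the last letter $a$ of the current word satisfies $\lambda_{a+1}=0$, in which case the output is false, or the current word is empty, in which case the output is true. (One of the two always happens after finitely many steps.) **Theorem.** For every standard word $u$ of length $n$ and every partition $\lambda$ of $n$, the algorithm with input $(u,\lambda)$ outputs true if and only if $P(u)$ is $\lambda$-catabolizable. -/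

import Mathlib

namespace CatInsertion

/-! ### Words, tableaux and row insertion -/

/-- A standard word of length `n`: a word in which each of `1, …, n` occurs exactly once. -/
def IsStandardWord (n : ℕ) (w : List ℕ) : Prop :=
  w.Perm (List.range' 1 n)

/-- A tableau in English notation, given by the list of its (nonempty) rows from north to south,
each row being listed from west to east. -/
abbrev Tableau : Type := List (List ℕ)

/-- Row insertion of `x` into one row: `x` replaces the leftmost entry that is larger than `x`, and
that entry is returned as bumped; if there is no such entry, `x` is put at the end of the row. -/
def insertRow : List ℕ → ℕ → List ℕ × Option ℕ
  | [], x => ([x], none)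
  | b :: r, x =>
    if x < b then (x :: r, some b)
    else (b :: (insertRow r x).1, (insertRow r x).2)

/-- Schensted row insertion of `x` into a tableau: an entry bumped from a row is inserted into the
next row. -/
def insertTableau : Tableau → ℕ → Tableau
  | [], x => [[x]]
  | r :: T, x =>
    match insertRow r x with
    | (r', none) => r' :: T
    | (r', some b) => r' :: insertTableau T b

/-- The insertion tableau `P(w)`: insert the letters of `w` from left to right, starting with the
empty tableau. -/
def P (w : List ℕ) : Tableau :=
  w.foldl insertTableau []

/-- The row reading word: the rows are read from south to north, each from west to east. -/
def rowword (T : Tableau) : List ℕ :=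
  T.reverse.flatten

/-! ### Catabolism -/

/-- The first (northernmost) row of `T`; empty for the empty tableau. -/
def firstRow (T : Tableau) : List ℕ := T.headD []

/-- The `m`-catabolism `Cat_m(T) = H_1(T - T_{(m)})`: remove the first `m` entries of the first row,
and insert what is left of the first row followed by the row reading word of the other rows. -/
def catabolism (m : ℕ) (T : Tableau) : Tableau :=
  P ((firstRow T).drop m ++ rowword T.tail)

/-- `T_{(m)}`, the subtableau of one row of length `m`, exists and contains the `m` smallest entries
of `T`. -/
def FirstRowHasSmallest (m : ℕ) (T : Tableau) : Prop :=
  m ≤ (firstRow T).length ∧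
    ∀ x ∈ (firstRow T).take m, ∀ y ∈ (firstRow T).drop m ++ rowword T.tail, x ≤ y

/-- `λ`-catabolizability of a tableau, where `λ = (λ₁, λ₂, …)` is the list of its parts. -/
def CatabolizableList : List ℕ → Tableau → Prop
  | [], T => T = []
  | m :: lam, T => FirstRowHasSmallest m T ∧ CatabolizableList lam (catabolism m T)

/-- The parts of a partition in weakly decreasing order. -/
def partList {n : ℕ} (lam : n.Partition) : List ℕ :=
  lam.parts.sort (· ≥ ·)

/-- `T` is `λ`-catabolizable. -/
def IsCatabolizable {n : ℕ} (lam : n.Partition) (T : Tableau) : Prop :=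
  CatabolizableList (partList lam) T

/-! ### The cocharge labeling -/

/-- The cocharge label of the number `i` in the standard word `w`: the number `1` has label `0`;
if `i` has label `k`, then `i + 1` has label `k` if it stands to the right of `i`, and label
`k + 1` if it stands to the left of `i`. (The value at `i = 0` is irrelevant.) -/
def cochargeLabel (w : List ℕ) : ℕ → ℕ
  | 0 => 0
  | 1 => 0
  | i + 2 =>
    if w.idxOf (i + 1) < w.idxOf (i + 2) then cochargeLabel w (i + 1)
    else cochargeLabel w (i + 1) + 1

/-- The cocharge labeling of a standard word. -/
def cochargeLabeling (w : List ℕ) : List ℕ :=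
  w.map (cochargeLabel w)

/-! ### The bounded catabolism insertion algorithm

A sequence `ν = (ν₁, ν₂, …)` is a function `ℕ → ℕ` with `ν i` standing for `ν_{i+1}`; hence
`ν + Pi.single a 1` is `ν + ε_{a+1}`, and (for finitely supported `ν`) `Antitone ν` says that `ν` is
a partition. For a list `lam` of parts, `lam.getD a 0` is `λ_{a+1}`. -/

open Classical in
/-- The function `f_λ`, applied to the pair `(y a, ν)`, where `a` is the last letter. -/
noncomputable def boundedStep (lam : List ℕ) (y : List ℕ) (a : ℕ) (ν : ℕ → ℕ) :
    List ℕ × (ℕ → ℕ) :=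
  if Antitone (ν + Pi.single a 1) ∧ ν a + 1 ≤ lam.getD a 0 then (y, ν + Pi.single a 1)
  else ((a + 1) :: y, ν)

/-- A quantity that drops in every step that presents some `a` with `λ_{a+1} ≠ 0`. -/
def runMeasure (l : ℕ) (x : List ℕ) : ℕ := (x.map (fun b => l + 1 - b)).sum

theorem runMeasure_boundedStep_lt (lam x : List ℕ) (ν : ℕ → ℕ) (h : x ≠ [])
    (h0 : ¬ lam.getD (x.getLast h) 0 = 0) :
    runMeasure lam.length (boundedStep lam x.dropLast (x.getLast h) ν).1 <
      runMeasure lam.length x := by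
  have ha : x.getLast h < lam.length := by
    by_contra hc
    exact h0 (List.getD_eq_default _ _ (not_lt.mp hc))
  have hx : runMeasure lam.length x =
      runMeasure lam.length x.dropLast + (lam.length + 1 - x.getLast h) := by
    conv_lhs => rw [← List.dropLast_append_getLast h]
    simp [runMeasure]
  rw [hx]
  unfold boundedStep
  split_ifs
  · simp only []
    omega
  · simp only [runMeasure, List.map_cons, List.sum_cons]
    omega

/-- Apply `f_λ` repeatedly to `(x, ν)` until the word is empty (output `true`) or a number `a` is
presented with `λ_{a+1} = 0` (output `false`). -/
noncomputable def boundedRun (lam : List ℕ) (x : List ℕ) (ν : ℕ → ℕ) : Bool :=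
  if h : x = [] then true
  else if h0 : lam.getD (x.getLast h) 0 = 0 then false
  else
    boundedRun lam (boundedStep lam x.dropLast (x.getLast h) ν).1
      (boundedStep lam x.dropLast (x.getLast h) ν).2
termination_by runMeasure lam.length x
decreasing_by exact runMeasure_boundedStep_lt lam x ν h h0

/-- The output of the bounded catabolism insertion algorithm on input `(w, λ)`: it starts with the
pair `(cocharge labeling of w, ∅)`. -/
noncomputable def boundedCatabolismInsertion {n : ℕ} (w : List ℕ) (lam : n.Partition) : Bool :=
  boundedRun (partList lam) (cochargeLabeling w) 0

end CatInsertion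

namespace CatInsertion

/-! ### Single steps of the algorithm -/

/-! The output of the algorithm depends only on the Knuth class of the input, and on a row reading
word the algorithm performs one catabolism visibly; induction on the parts of the partition then
gives the theorem.

Knuth invariance: an elementary Knuth move on a standard word swaps two values that differ by at
least 2, so every value keeps its cocharge label. On labels the move is either a commutation of
letters differing by at least 2, or a Knuth move on letters `a`, `a + 1`. `boundedRun_localMove`
shows that these do not affect the output: two rejected letters reappear at the front, each raised
by 1, and form a move of the same kind, so an induction on `runMeasure` closes up once one adds the
swap of `a`, `a + 1` when row `a` is full. Hence `w` may be replaced by `rowword (P w)`.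

One catabolism: suppose the first row is `t r`, with `t` the `m` smallest letters, and let `z` be
the reading word of the lower rows. The letters of `t` have label 0, those of `z` positive labels.
The algorithm rotates the nonzero labels of `r` to the front, fills row 0 with `m` zeros, then
rotates the surplus zeros. What remains is the labeling of `r z` with all letters raised by 1
(`isLabeling_catabolism`), and with row 0 full the run imitates the run for the remaining parts
(`boundedRun_consSeq`).

Conversely, rejection never creates a letter 0, so an accepted labeling has at least `m` zeros
(`getD_zero_le_of_boundedRun`). Then the `m` smallest letters occur in increasing order in the
reading word, which forces them into the first row. -/

/-- The letter `a` can be added to the partition `ν` within the bound `lam`. -/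
def Insertable (lam : List ℕ) (ν : ℕ → ℕ) (a : ℕ) : Prop :=
  (∀ b, b + 1 = a → ν a < ν b) ∧ ν a < lam.getD a 0

/-- The parts of `lam`, continued by zeros, decrease weakly. -/
def Decreasing (lam : List ℕ) : Prop := Antitone fun i => lam.getD i 0

theorem add_single_apply (ν : ℕ → ℕ) (a b : ℕ) :
    (ν + Pi.single a 1 : ℕ → ℕ) b = ν b + if b = a then 1 else 0 := by
  simp [Pi.single_apply]

theorem antitone_add_single_iff {ν : ℕ → ℕ} (hν : Antitone ν) (a : ℕ) :
    Antitone (ν + Pi.single a 1 : ℕ → ℕ) ↔ ∀ b, b + 1 = a → ν a < ν b := by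
  constructor
  · rintro h b rfl
    have := h (Nat.le_succ b)
    simp only [add_single_apply] at this
    simp at this
    omega
  · intro h
    refine antitone_nat_of_succ_le fun i => ?_
    have h1 := hν (Nat.le_succ i)
    have h2 := h i
    simp only [add_single_apply]
    split_ifs with h3 h4 h4
    · omega
    · subst h3
      have := h2 rfl
      omega
    · simp only [Nat.succ_eq_add_one] at h1
      omega
    · simpa using h1

theorem boundedStep_condition_iff {lam : List ℕ} {ν : ℕ → ℕ} (hν : Antitone ν) (a : ℕ) :
    (Antitone (ν + Pi.single a 1 : ℕ → ℕ) ∧ ν a + 1 ≤ lam.getD a 0) ↔ Insertable lam ν a := by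
  rw [antitone_add_single_iff hν]
  rfl

theorem Insertable.antitone {lam : List ℕ} {ν : ℕ → ℕ} {a : ℕ} (hν : Antitone ν)
    (h : Insertable lam ν a) : Antitone (ν + Pi.single a 1 : ℕ → ℕ) :=
  (antitone_add_single_iff hν a).2 h.1

theorem lt_length_of_getD_ne_zero {lam : List ℕ} {a : ℕ} (h : lam.getD a 0 ≠ 0) :
    a < lam.length := by
  by_contra hc
  exact h (List.getD_eq_default _ _ (not_lt.mp hc))

theorem boundedRun_nil (lam : List ℕ) (ν : ℕ → ℕ) : boundedRun lam [] ν = true := by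
  rw [boundedRun]
  simp

theorem boundedRun_concat_of_ne (lam y : List ℕ) (a : ℕ) (ν : ℕ → ℕ) (h : lam.getD a 0 ≠ 0) :
    boundedRun lam (y ++ [a]) ν =
      boundedRun lam (boundedStep lam y a ν).1 (boundedStep lam y a ν).2 := by
  rw [boundedRun]
  simp only [List.getLast_append_singleton, List.dropLast_concat]
  rw [dif_neg (by simp), dif_neg h]

theorem boundedRun_concat_of_eq (lam y : List ℕ) (a : ℕ) (ν : ℕ → ℕ) (h : lam.getD a 0 = 0) :
    boundedRun lam (y ++ [a]) ν = false := by
  rw [boundedRun]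
  simp only [List.getLast_append_singleton, List.dropLast_concat]
  rw [dif_neg (by simp), dif_pos h]

theorem runMeasure_append (l : ℕ) (x y : List ℕ) :
    runMeasure l (x ++ y) = runMeasure l x + runMeasure l y := by
  simp [runMeasure]

theorem runMeasure_cons (l a : ℕ) (x : List ℕ) :
    runMeasure l (a :: x) = (l + 1 - a) + runMeasure l x := by
  simp [runMeasure]

theorem runMeasure_nil (l : ℕ) : runMeasure l [] = 0 := rfl

/-- A word with a letter beyond the length of `lam` is rejected. -/
theorem boundedRun_eq_false {lam : List ℕ} :
    ∀ (N : ℕ) (x : List ℕ) (ν : ℕ → ℕ), runMeasure lam.length x = N →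
      (∃ a ∈ x, lam.getD a 0 = 0) → boundedRun lam x ν = false := by
  intro N
  induction N using Nat.strong_induction_on with
  | _ N ih =>
    intro x ν hN hx
    rcases List.eq_nil_or_concat' x with rfl | ⟨y, d, rfl⟩
    · simp at hx
    by_cases hd : lam.getD d 0 = 0
    · exact boundedRun_concat_of_eq _ _ _ _ hd
    have hlt := lt_length_of_getD_ne_zero hd
    obtain ⟨a, ha, ha0⟩ := hx
    have hay : a ∈ y := by
      rcases List.mem_append.1 ha with h | h
      · exact h
      · rw [List.mem_singleton.1 h] at ha0
        exact absurd ha0 hd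
    rw [boundedRun_concat_of_ne _ _ _ _ hd]
    rw [runMeasure_append, runMeasure_cons, runMeasure_nil] at hN
    unfold boundedStep
    split_ifs
    · refine ih _ ?_ _ _ rfl ⟨a, hay, ha0⟩
      dsimp only
      omega
    · refine ih _ ?_ _ _ rfl ⟨a, List.mem_cons_of_mem _ hay, ha0⟩
      rw [runMeasure_cons]
      omega

-- The stopping rule for output false can be absorbed into ordinary rejection: if row `a` has bound
-- 0, so has row `a + 1`, and a word containing such a letter is rejected anyway. This leaves a
-- recursion with only two cases.
open Classical in
theorem boundedRun_concat {lam : List ℕ} (hlam : Decreasing lam) {ν : ℕ → ℕ} (hν : Antitone ν)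
    (y : List ℕ) (a : ℕ) :
    boundedRun lam (y ++ [a]) ν =
      if Insertable lam ν a then boundedRun lam y (ν + Pi.single a 1)
      else boundedRun lam ((a + 1) :: y) ν := by
  by_cases ha : lam.getD a 0 = 0
  · rw [boundedRun_concat_of_eq _ _ _ _ ha,
      if_neg (by simp [Insertable, -List.getD_eq_getElem?_getD, ha])]
    refine (boundedRun_eq_false _ _ _ rfl ⟨a + 1, List.mem_cons_self, ?_⟩).symm
    have := hlam (Nat.le_succ a)
    simp only [ha] at this
    exact Nat.le_zero.1 this
  · rw [boundedRun_concat_of_ne _ _ _ _ ha]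
    unfold boundedStep
    simp only [boundedStep_condition_iff hν]
    split_ifs <;> rfl

theorem boundedRun_concat_of_insertable {lam : List ℕ} (hlam : Decreasing lam) {ν : ℕ → ℕ}
    (hν : Antitone ν) (y : List ℕ) {a : ℕ} (h : Insertable lam ν a) :
    boundedRun lam (y ++ [a]) ν = boundedRun lam y (ν + Pi.single a 1) := by
  rw [boundedRun_concat hlam hν, if_pos h]

theorem boundedRun_concat_of_not_insertable {lam : List ℕ} (hlam : Decreasing lam) {ν : ℕ → ℕ}
    (hν : Antitone ν) (y : List ℕ) {a : ℕ} (h : ¬ Insertable lam ν a) :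
    boundedRun lam (y ++ [a]) ν = boundedRun lam ((a + 1) :: y) ν := by
  rw [boundedRun_concat hlam hν, if_neg h]

/-! ### Invariance under local moves -/

theorem insertable_add_single_of_ne {lam : List ℕ} {ν : ℕ → ℕ} {a b : ℕ} (h : b ≠ a)
    (h' : b ≠ a + 1) : Insertable lam (ν + Pi.single a 1) b ↔ Insertable lam ν b := by
  unfold Insertable
  simp only [add_single_apply, if_neg h, add_zero]
  refine and_congr_left fun _ => forall₂_congr fun c hc => ?_
  rw [if_neg (by omega), add_zero]

/-- Lengthening row `a` can help `a + 1` only by creating the strict descent between the two rows,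
and here that descent is already present. -/
theorem insertable_add_single_succ {lam : List ℕ} {ν : ℕ → ℕ} {a : ℕ} (h : ν (a + 1) < ν a) :
    Insertable lam (ν + Pi.single a 1) (a + 1) ↔ Insertable lam ν (a + 1) := by
  unfold Insertable
  simp only [add_single_apply]
  refine and_congr ⟨?_, ?_⟩ (by simp)
  · rintro - b hb
    obtain rfl : b = a := by omega
    exact h
  · rintro - b hb
    obtain rfl : b = a := by omega
    simp
    omega

/-- Two adjacent letters at the end may be interchanged if neither insertion influences the other,
provided that this remains true after both have been moved to the front. -/
theorem boundedRun_pair_comm {lam : List ℕ} (hlam : Decreasing lam) {ν : ℕ → ℕ} (hν : Antitone ν)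
    (y : List ℕ) {a c : ℕ} (hac : a < c)
    (h : Insertable lam ν a → (Insertable lam (ν + Pi.single a 1) c ↔ Insertable lam ν c))
    (hmove : ¬ Insertable lam ν a → ¬ Insertable lam ν c →
      boundedRun lam ((a + 1) :: (c + 1) :: y) ν = boundedRun lam ((c + 1) :: (a + 1) :: y) ν) :
    boundedRun lam (y ++ [a, c]) ν = boundedRun lam (y ++ [c, a]) ν := by
  have h' : Insertable lam (ν + Pi.single c 1) a ↔ Insertable lam ν a :=
    insertable_add_single_of_ne (by omega) (by omega)
  have e1 : y ++ [a, c] = (y ++ [a]) ++ [c] := by simp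
  have e2 : y ++ [c, a] = (y ++ [c]) ++ [a] := by simp
  rw [e1, e2]
  by_cases ha : Insertable lam ν a <;> by_cases hc : Insertable lam ν c
  · rw [boundedRun_concat_of_insertable hlam hν _ hc, boundedRun_concat_of_insertable hlam hν _ ha,
      boundedRun_concat_of_insertable hlam (hc.antitone hν) _ (h'.2 ha),
      boundedRun_concat_of_insertable hlam (ha.antitone hν) _ ((h ha).2 hc), add_right_comm]
  · rw [boundedRun_concat_of_not_insertable hlam hν _ hc,
      boundedRun_concat_of_insertable hlam hν _ ha, ← List.cons_append,
      boundedRun_concat_of_insertable hlam hν _ ha,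
      boundedRun_concat_of_not_insertable hlam (ha.antitone hν) _ (mt (h ha).1 hc)]
  · rw [boundedRun_concat_of_insertable hlam hν _ hc,
      boundedRun_concat_of_not_insertable hlam hν _ ha, ← List.cons_append,
      boundedRun_concat_of_not_insertable hlam (hc.antitone hν) _ (mt h'.1 ha),
      boundedRun_concat_of_insertable hlam hν _ hc]
  · rw [boundedRun_concat_of_not_insertable hlam hν _ hc,
      boundedRun_concat_of_not_insertable hlam hν _ ha, ← List.cons_append, ← List.cons_append,
      boundedRun_concat_of_not_insertable hlam hν _ ha,
      boundedRun_concat_of_not_insertable hlam hν _ hc, hmove ha hc]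

/-- The local moves that do not change the output of the algorithm: far commutations, the Knuth
moves on two consecutive letters, and the interchange of `a` and `a + 1` once row `a` is full. -/
inductive LocalMove (lam : List ℕ) (ν : ℕ → ℕ) : List ℕ → List ℕ → Prop
  | far (a c : ℕ) : a + 2 ≤ c → LocalMove lam ν [a, c] [c, a]
  | full (a : ℕ) : lam.getD a 0 ≤ ν a → LocalMove lam ν [a, a + 1] [a + 1, a]
  | knuthLeft (a : ℕ) : LocalMove lam ν [a, a + 1, a] [a + 1, a, a]
  | knuthRight (a : ℕ) : LocalMove lam ν [a + 1, a, a + 1] [a + 1, a + 1, a]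

theorem LocalMove.perm {lam : List ℕ} {ν : ℕ → ℕ} {s t : List ℕ} (h : LocalMove lam ν s t) :
    s.Perm t := by
  cases h with
  | far a c => exact List.Perm.swap _ _ _
  | full a => exact List.Perm.swap _ _ _
  | knuthLeft a => exact List.Perm.swap _ _ _
  | knuthRight a => exact (List.Perm.swap _ _ _).cons _

/-- Letters to the right of the move may be inserted before it is reached; a full row stays full
when `ν` grows. -/
theorem LocalMove.mono {lam : List ℕ} {ν : ℕ → ℕ} {s t : List ℕ} (h : LocalMove lam ν s t)
    (d : ℕ) : LocalMove lam (ν + Pi.single d 1) s t := by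
  cases h with
  | far a c h => exact .far a c h
  | full a h => exact .full a (h.trans (by rw [add_single_apply]; omega))
  | knuthLeft a => exact .knuthLeft a
  | knuthRight a => exact .knuthRight a

/-- Letters to the right of the window are processed identically on both sides until the window is
at the end of the word. If its letters are then rejected, the window reappears at the front as the
same type of move, raised by 1. The measure drops each time, because words with a letter out of
bounds are discarded beforehand. -/
theorem boundedRun_localMove {lam : List ℕ} (hlam : Decreasing lam) :
    ∀ (N : ℕ) (p s t q : List ℕ) (ν : ℕ → ℕ), runMeasure lam.length (p ++ s ++ q) = N →
      Antitone ν → LocalMove lam ν s t →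
      boundedRun lam (p ++ s ++ q) ν = boundedRun lam (p ++ t ++ q) ν := by
  intro N
  induction N using Nat.strong_induction_on with
  | _ N ih =>
    intro p s t q ν hN hν hst
    by_cases hz : ∃ a ∈ p ++ s ++ q, lam.getD a 0 = 0
    · rw [boundedRun_eq_false _ _ _ rfl hz]
      obtain ⟨a, ha, ha0⟩ := hz
      exact (boundedRun_eq_false _ _ _ rfl
        ⟨a, (((hst.perm.append_left p).append_right q).mem_iff).1 ha, ha0⟩).symm
    have hlt : ∀ a ∈ p ++ s ++ q, a < lam.length := fun a ha =>
      lt_length_of_getD_ne_zero fun h => hz ⟨a, ha, h⟩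
    rcases List.eq_nil_or_concat' q with rfl | ⟨q', d, rfl⟩
    · simp only [List.append_nil] at hN hlt ⊢
      cases hst with
      | far a c hac =>
        refine boundedRun_pair_comm hlam hν p (by omega)
          (fun _ => insertable_add_single_of_ne (by omega) (by omega)) fun _ _ => ?_
        have ha := hlt a (by simp)
        refine ih _ ?_ [] _ _ p ν rfl hν (.far (a + 1) (c + 1) (by omega))
        simp only [runMeasure_append, runMeasure_cons, runMeasure_nil] at hN ⊢
        omega
      | full a h =>
        refine boundedRun_pair_comm hlam hν p (by omega)
          (fun h' => absurd h'.2 (not_lt.2 h)) fun _ hc => ?_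
        have ha := hlt a (by simp)
        refine ih _ ?_ [] _ _ p ν rfl hν (.full (a + 1) ?_)
        · simp only [runMeasure_append, runMeasure_cons, runMeasure_nil] at hN ⊢
          omega
        -- If row `a + 1` had room, its length would be less than its bound, hence less than the
        -- bound of row `a`, which row `a` has reached. Then `a + 1` would be insertable; so row `a
        -- + 1` is full as well.
        · by_contra hcon
          refine hc ⟨fun b hb => ?_, not_le.1 hcon⟩
          obtain rfl : b = a := by omega
          have := hlam (Nat.le_succ b)
          simp only [Nat.succ_eq_add_one] at this
          omega
      | knuthLeft a =>
        have ha := hlt a (by simp)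
        have e1 : p ++ [a, a + 1, a] = (p ++ [a, a + 1]) ++ [a] := by simp
        have e2 : p ++ [a + 1, a, a] = (p ++ [a + 1, a]) ++ [a] := by simp
        rw [e1, e2]
        -- Inserting the last `a` makes row `a` strictly longer than row `a + 1`, so the next two
        -- letters no longer interact; if `a + 1` is still rejected, its row is full. If the last
        -- `a` is rejected, so is any other `a` presented before row `a - 1` or row `a` changes, and
        -- the raised triple is again a left Knuth move.
        by_cases hi : Insertable lam ν a
        · rw [boundedRun_concat_of_insertable hlam hν _ hi,
            boundedRun_concat_of_insertable hlam hν _ hi]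
          have hlt' : (ν + Pi.single a 1 : ℕ → ℕ) (a + 1) < (ν + Pi.single a 1 : ℕ → ℕ) a := by
            have := hν (Nat.le_succ a)
            simp only [add_single_apply]
            simp
            simp only [Nat.succ_eq_add_one] at this
            omega
          refine boundedRun_pair_comm hlam (hi.antitone hν) p (by omega)
            (fun _ => insertable_add_single_succ hlt') fun _ hc => ?_
          refine ih _ ?_ [] _ _ p _ rfl (hi.antitone hν) (.full (a + 1) ?_)
          · simp only [runMeasure_append, runMeasure_cons, runMeasure_nil] at hN ⊢
            omega
          · by_contra hcon
            refine hc ⟨fun b hb => ?_, not_le.1 hcon⟩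
            obtain rfl : b = a := by omega
            exact hlt'
        · rw [boundedRun_concat_of_not_insertable hlam hν _ hi,
            boundedRun_concat_of_not_insertable hlam hν _ hi, ← List.cons_append,
            ← List.cons_append]
          refine boundedRun_pair_comm hlam hν _ (by omega) (fun h => absurd h hi) fun _ _ => ?_
          refine ih _ ?_ [] _ _ p ν rfl hν (.knuthLeft (a + 1))
          simp only [runMeasure_append, runMeasure_cons, runMeasure_nil] at hN ⊢
          omega
      | knuthRight a =>
        have ha := hlt a (by simp)
        have ha' := hlt (a + 1) (by simp)
        have e1 : p ++ [a + 1, a, a + 1] = (p ++ [a + 1]) ++ [a, a + 1] := by simp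
        have e2 : p ++ [a + 1, a + 1, a] = (p ++ [a + 1]) ++ [a + 1, a] := by simp
        rw [e1, e2]
        -- The only interaction: `a + 1` becomes insertable just because `a` was inserted. Then on
        -- either side exactly one `a` and one `a + 1` are inserted and the other `a + 1` is
        -- rejected, as row `a` admits one new box below it and no more.
        by_cases hdep : Insertable lam ν a ∧ Insertable lam (ν + Pi.single a 1) (a + 1) ∧
          ¬ Insertable lam ν (a + 1)
        · obtain ⟨h1, h2, h3⟩ := hdep
          have h4 : ¬ Insertable lam (ν + Pi.single a 1 + Pi.single (a + 1) 1) (a + 1) := by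
            intro h4
            have h5 := h4.1 a rfl
            have h6 := h2.2
            simp only [add_single_apply] at h5 h6
            simp at h5 h6
            refine h3 ⟨fun b hb => ?_, ?_⟩
            · obtain rfl : b = a := by omega
              exact h5
            · simpa using h6
          have f1 : (p ++ [a + 1]) ++ [a, a + 1] = ((p ++ [a + 1]) ++ [a]) ++ [a + 1] := by simp
          have f2 : (p ++ [a + 1]) ++ [a + 1, a] = ((p ++ [a + 1]) ++ [a + 1]) ++ [a] := by simp
          rw [f1, f2, boundedRun_concat_of_not_insertable hlam hν _ h3, ← List.cons_append,
            boundedRun_concat_of_insertable hlam hν _ h1, ← List.cons_append,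
            boundedRun_concat_of_insertable hlam (h1.antitone hν) _ h2,
            boundedRun_concat_of_insertable hlam hν _ h1,
            boundedRun_concat_of_insertable hlam (h1.antitone hν) _ h2,
            boundedRun_concat_of_not_insertable hlam (h2.antitone (h1.antitone hν)) _ h4]
        · refine boundedRun_pair_comm hlam hν _ (by omega) (fun h => ⟨fun h' => ?_, fun h' => ?_⟩)
            fun hna hnc => ?_
          · by_contra hcon
            exact hdep ⟨h, h', hcon⟩
          · refine ⟨fun b hb => ?_, ?_⟩
            · obtain rfl : b = a := by omega
              have := h'.1 b rfl
              simp only [add_single_apply]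
              simp
              omega
            · have := h'.2
              simp only [add_single_apply]
              simpa using this
          -- The third letter `a + 1` is rejected as well, so the whole triple moves to the front
          -- and is a right Knuth move for `a + 1`.
          · rw [← List.cons_append, ← List.cons_append, ← List.cons_append, ← List.cons_append,
              boundedRun_concat_of_not_insertable hlam hν _ hnc,
              boundedRun_concat_of_not_insertable hlam hν _ hnc]
            refine ih _ ?_ [] _ _ p ν rfl hν (.knuthRight (a + 1))
            simp only [runMeasure_append, runMeasure_cons, runMeasure_nil] at hN ⊢
            omega
    · have hd := hlt d (by simp)
      rw [← List.append_assoc, ← List.append_assoc]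
      by_cases hi : Insertable lam ν d
      · rw [boundedRun_concat_of_insertable hlam hν _ hi,
          boundedRun_concat_of_insertable hlam hν _ hi]
        refine ih _ ?_ p s t q' _ rfl (hi.antitone hν) (hst.mono d)
        simp only [runMeasure_append, runMeasure_cons, runMeasure_nil] at hN ⊢
        omega
      · rw [boundedRun_concat_of_not_insertable hlam hν _ hi,
          boundedRun_concat_of_not_insertable hlam hν _ hi]
        refine ih _ ?_ ((d + 1) :: p) s t q' ν rfl hν hst
        simp only [runMeasure_append, runMeasure_cons, runMeasure_nil, List.cons_append] at hN ⊢
        omega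

/-! ### Knuth equivalence -/

/-- An elementary Knuth move. -/
inductive KnuthMove : List ℕ → List ℕ → Prop
  | left (p q : List ℕ) (a b c : ℕ) : a ≤ b → b < c →
      KnuthMove (p ++ [a, c, b] ++ q) (p ++ [c, a, b] ++ q)
  | right (p q : List ℕ) (a b c : ℕ) : a < b → b ≤ c →
      KnuthMove (p ++ [b, a, c] ++ q) (p ++ [b, c, a] ++ q)

/-- Knuth equivalence of words. -/
def KnuthEquiv : List ℕ → List ℕ → Prop := Relation.EqvGen KnuthMove

theorem KnuthEquiv.refl (v : List ℕ) : KnuthEquiv v v := Relation.EqvGen.refl v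

theorem KnuthEquiv.symm {v w : List ℕ} (h : KnuthEquiv v w) : KnuthEquiv w v :=
  Relation.EqvGen.symm _ _ h

theorem KnuthEquiv.trans {u v w : List ℕ} (h : KnuthEquiv u v) (h' : KnuthEquiv v w) :
    KnuthEquiv u w :=
  Relation.EqvGen.trans _ _ _ h h'

theorem KnuthMove.append (p q : List ℕ) {v w : List ℕ} (h : KnuthMove v w) :
    KnuthMove (p ++ v ++ q) (p ++ w ++ q) := by
  cases h with
  | left p' q' a b c h h' => simpa using KnuthMove.left (p ++ p') (q' ++ q) a b c h h'
  | right p' q' a b c h h' => simpa using KnuthMove.right (p ++ p') (q' ++ q) a b c h h'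

theorem KnuthMove.perm {v w : List ℕ} (h : KnuthMove v w) : v.Perm w := by
  cases h with
  | left p q a b c => exact ((List.Perm.swap _ _ _).append_left p).append_right q
  | right p q a b c => exact (((List.Perm.swap _ _ _).cons _).append_left p).append_right q

theorem KnuthEquiv.append (p q : List ℕ) {v w : List ℕ} (h : KnuthEquiv v w) :
    KnuthEquiv (p ++ v ++ q) (p ++ w ++ q) := by
  induction h with
  | rel _ _ h => exact .rel _ _ (h.append p q)
  | refl _ => exact .refl _
  | symm _ _ _ ih => exact ih.symm
  | trans _ _ _ _ _ ih ih' => exact ih.trans ih'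

theorem KnuthEquiv.perm {v w : List ℕ} (h : KnuthEquiv v w) : v.Perm w := by
  induction h with
  | rel _ _ h => exact h.perm
  | refl _ => exact .refl _
  | symm _ _ _ ih => exact ih.symm
  | trans _ _ _ _ _ ih ih' => exact ih.trans ih'

theorem KnuthEquiv.append_left (p : List ℕ) {v w : List ℕ} (h : KnuthEquiv v w) :
    KnuthEquiv (p ++ v) (p ++ w) := by
  simpa using h.append p []

theorem KnuthEquiv.append_right (q : List ℕ) {v w : List ℕ} (h : KnuthEquiv v w) :
    KnuthEquiv (v ++ q) (w ++ q) := by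
  simpa using h.append [] q

/-! ### Row insertion and Knuth equivalence -/

/-- The small letter `x` travels left through the increasing row; at each step the left neighbour of
the swapped pair serves as the witness of the Knuth move. -/
theorem knuthEquiv_cons_concat {x : ℕ} (l : List ℕ) (y : ℕ) (hx : x < y)
    (hl : (y :: l).Pairwise (· ≤ ·)) : KnuthEquiv (y :: (l ++ [x])) (y :: x :: l) := by
  induction l generalizing y with
  | nil => exact .refl _
  | cons d l ih =>
    have hyd : y ≤ d := (List.pairwise_cons.1 hl).1 d List.mem_cons_self
    refine ((ih d (hx.trans_le hyd) (List.pairwise_cons.1 hl).2).append_left [y]).trans ?_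
    exact (Relation.EqvGen.rel _ _ (KnuthMove.right [] l x y d hx hyd)).symm

theorem mem_insertRow {r : List ℕ} {x y : ℕ} (h : y ∈ (insertRow r x).1) : y = x ∨ y ∈ r := by
  induction r with
  | nil => simpa [insertRow] using h
  | cons b r ih =>
    simp only [insertRow] at h
    split_ifs at h
    · rcases List.mem_cons.1 h with h | h
      · exact .inl h
      · exact .inr (List.mem_cons_of_mem _ h)
    · rcases List.mem_cons.1 h with h | h
      · exact .inr (h ▸ List.mem_cons_self)
      · exact (ih h).imp_right (List.mem_cons_of_mem _)

theorem pairwise_insertRow {r : List ℕ} (hr : r.Pairwise (· ≤ ·)) (x : ℕ) :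
    (insertRow r x).1.Pairwise (· ≤ ·) := by
  induction r with
  | nil => simp [insertRow]
  | cons b r ih =>
    rw [List.pairwise_cons] at hr
    simp only [insertRow]
    split_ifs with h
    · exact List.pairwise_cons.2 ⟨fun y hy => h.le.trans (hr.1 y hy), hr.2⟩
    · refine List.pairwise_cons.2 ⟨fun y hy => ?_, ih hr.2⟩
      rcases mem_insertRow hy with rfl | hy
      · exact not_lt.1 h
      · exact hr.1 y hy

theorem insertRow_of_none {r : List ℕ} {x : ℕ} (h : (insertRow r x).2 = none) :
    (insertRow r x).1 = r ++ [x] := by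
  induction r with
  | nil => rfl
  | cons b r ih =>
    simp only [insertRow] at h ⊢
    split_ifs at h ⊢
    simp [ih h]

/-- The bound on the head `e` of the new row is carried along for the induction: it gives `d ≤ e <
b`, which lets the bumped letter `b` pass `d` by a Knuth move with witness `e`. -/
theorem insertRow_of_some {r : List ℕ} (hr : r.Pairwise (· ≤ ·)) {x b : ℕ}
    (h : (insertRow r x).2 = some b) :
    x < b ∧ (∃ e t, (insertRow r x).1 = e :: t ∧ e ≤ x) ∧
      KnuthEquiv (r ++ [x]) (b :: (insertRow r x).1) := by
  induction r with
  | nil => simp [insertRow] at h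
  | cons d r ih =>
    have hr' := List.pairwise_cons.1 hr
    have hs := pairwise_insertRow hr x
    simp only [insertRow] at h hs ⊢
    split_ifs at h hs ⊢ with hd
    · obtain rfl : d = b := by simpa using h
      exact ⟨hd, ⟨x, r, rfl, le_rfl⟩, knuthEquiv_cons_concat r d hd hr⟩
    · obtain ⟨h1, ⟨e, t, h2, h3⟩, h4⟩ := ih hr'.2 h
      refine ⟨h1, ⟨d, _, rfl, not_lt.1 hd⟩, ?_⟩
      refine (h4.append_left [d]).trans ?_
      rw [h2] at hs ⊢
      exact .rel _ _ (KnuthMove.left [] t d e b ((List.pairwise_cons.1 hs).1 e List.mem_cons_self)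
        (h3.trans_lt h1))

/-! ### Insertion tableaux -/

theorem rowword_cons (r : List ℕ) (T : Tableau) : rowword (r :: T) = rowword T ++ r := by
  simp [rowword]

theorem rowword_eq (T : Tableau) : rowword T = rowword T.tail ++ firstRow T := by
  cases T with
  | nil => rfl
  | cons r T => exact rowword_cons r T

theorem insertTableau_cons_none {r : List ℕ} {x : ℕ} (T : Tableau)
    (h : (insertRow r x).2 = none) :
    insertTableau (r :: T) x = (insertRow r x).1 :: T := by
  rcases e : insertRow r x with ⟨r', o⟩
  rw [e] at h
  obtain rfl : o = none := h
  simp [insertTableau, e]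

theorem insertTableau_cons_some {r : List ℕ} {x b : ℕ} (T : Tableau)
    (h : (insertRow r x).2 = some b) :
    insertTableau (r :: T) x = (insertRow r x).1 :: insertTableau T b := by
  rcases e : insertRow r x with ⟨r', o⟩
  rw [e] at h
  obtain rfl : o = some b := h
  simp [insertTableau, e]

theorem rows_insertTableau {T : Tableau} (hT : ∀ r ∈ T, r.Pairwise (· ≤ ·)) (x : ℕ) :
    ∀ r ∈ insertTableau T x, r.Pairwise (· ≤ ·) := by
  induction T generalizing x with
  | nil => simp [insertTableau]
  | cons r T ih =>
    rw [List.forall_mem_cons] at hT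
    rcases h : (insertRow r x).2 with _ | b
    · rw [insertTableau_cons_none T h, List.forall_mem_cons]
      exact ⟨pairwise_insertRow hT.1 x, hT.2⟩
    · rw [insertTableau_cons_some T h, List.forall_mem_cons]
      exact ⟨pairwise_insertRow hT.1 x, ih hT.2 b⟩

theorem knuthEquiv_rowword_insertTableau {T : Tableau} (hT : ∀ r ∈ T, r.Pairwise (· ≤ ·))
    (x : ℕ) : KnuthEquiv (rowword T ++ [x]) (rowword (insertTableau T x)) := by
  induction T generalizing x with
  | nil => exact .refl _
  | cons r T ih =>
    rw [List.forall_mem_cons] at hT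
    rcases h : (insertRow r x).2 with _ | b
    · rw [insertTableau_cons_none T h, insertRow_of_none h]
      simpa [rowword_cons] using KnuthEquiv.refl _
    · rw [insertTableau_cons_some T h, rowword_cons, rowword_cons, List.append_assoc]
      refine ((insertRow_of_some hT.1 h).2.2.append_left _).trans ?_
      simpa using (ih hT.2 b).append_right (insertRow r x).1

theorem P_concat (w : List ℕ) (x : ℕ) : P (w ++ [x]) = insertTableau (P w) x := by
  simp [P]

theorem rows_P (w : List ℕ) : ∀ r ∈ P w, r.Pairwise (· ≤ ·) := by
  induction w using List.reverseRecOn with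
  | nil => simp [P]
  | append_singleton w x ih =>
    rw [P_concat]
    exact rows_insertTableau ih x

theorem knuthEquiv_rowword_P (w : List ℕ) : KnuthEquiv w (rowword (P w)) := by
  induction w using List.reverseRecOn with
  | nil => exact .refl _
  | append_singleton w x ih =>
    rw [P_concat]
    exact (ih.append_right [x]).trans (knuthEquiv_rowword_insertTableau (rows_P w) x)

theorem pairwise_firstRow_P (w : List ℕ) : (firstRow (P w)).Pairwise (· ≤ ·) := by
  have h := rows_P w
  revert h
  cases P w with
  | nil => simp [firstRow]
  | cons r T => exact fun h => h r List.mem_cons_self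

theorem firstRow_insertTableau_cons (r : List ℕ) (T : Tableau) (x : ℕ) :
    firstRow (insertTableau (r :: T) x) = (insertRow r x).1 := by
  rcases h : (insertRow r x).2 with _ | b
  · rw [insertTableau_cons_none T h]
    rfl
  · rw [insertTableau_cons_some T h]
    rfl

/-- The minimum sits in the northwest corner. It anchors the argument that the smallest letters lie
in the first row. -/
theorem P_eq_nil_or_head_le (w : List ℕ) :
    P w = [] ∨ ∃ e t, firstRow (P w) = e :: t ∧ ∀ y ∈ rowword (P w), e ≤ y := by
  induction w using List.reverseRecOn with
  | nil => exact .inl rfl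
  | append_singleton w x ih =>
    right
    have hmem : ∀ y ∈ rowword (insertTableau (P w) x), y ∈ rowword (P w) ∨ y = x := fun y hy => by
      simpa using ((knuthEquiv_rowword_insertTableau (rows_P w) x).perm.mem_iff).2 hy
    rw [P_concat]
    rcases ih with h | ⟨e, t, h, hle⟩
    · rw [h]
      exact ⟨x, [], rfl, by simp [insertTableau, rowword]⟩
    · rcases hP : P w with _ | ⟨r, T⟩
      · rw [hP] at h
        simp [firstRow] at h
      · rw [hP] at h hle hmem
        obtain rfl : r = e :: t := h
        rw [firstRow_insertTableau_cons]
        simp only [insertRow]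
        split_ifs with hx
        · refine ⟨x, t, rfl, fun y hy => ?_⟩
          rcases hmem y hy with hy | rfl
          · exact hx.le.trans (hle y hy)
          · exact le_rfl
        · refine ⟨e, _, rfl, fun y hy => ?_⟩
          rcases hmem y hy with hy | rfl
          · exact hle y hy
          · exact not_lt.1 hx

/-! ### Cocharge labelings of words on an interval -/

/-- `L` is the cocharge labeling of the word `w` in the letters `s + 1, …, s + n`. -/
def IsLabeling (s n : ℕ) (w : List ℕ) (L : ℕ → ℕ) : Prop :=
  (0 < n → L (s + 1) = 0) ∧ ∀ i, s + 1 ≤ i → i + 1 ≤ s + n →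
    L (i + 1) = L i + if w.idxOf i < w.idxOf (i + 1) then 0 else 1

theorem IsLabeling.mono {s n : ℕ} {w : List ℕ} {L : ℕ → ℕ} (h : IsLabeling s n w L) {i j : ℕ}
    (hi : s + 1 ≤ i) (hij : i ≤ j) (hj : j ≤ s + n) : L i ≤ L j := by
  induction j, hij using Nat.le_induction with
  | base => exact le_rfl
  | succ j hij ih =>
    rw [h.2 j (by omega) hj]
    exact (ih (by omega)).trans (Nat.le_add_right _ _)

/-- If the label stayed constant from `i` to `j`, the letters `i, i + 1, …, j` would stand from left
to right. -/
theorem IsLabeling.lt {s n : ℕ} {w : List ℕ} {L : ℕ → ℕ} (h : IsLabeling s n w L) {i j : ℕ}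
    (hi : s + 1 ≤ i) (hij : i < j) (hj : j ≤ s + n) (hw : w.idxOf j ≤ w.idxOf i) : L i < L j := by
  induction j, hij using Nat.le_induction with
  | base =>
    rw [h.2 i hi hj, if_neg (not_lt.2 hw)]
    omega
  | succ j hij ih =>
    rw [h.2 j (by omega) hj]
    split_ifs with hlt
    · exact ih (by omega) (hlt.le.trans hw)
    · have := h.mono hi (Nat.le_of_succ_le hij) (by omega)
      omega

theorem idxOf_lt_succ_iff_swap {p q : List ℕ} {a c : ℕ} (hac : a + 2 ≤ c)
    (hn : (p ++ a :: c :: q).Nodup) (i : ℕ) :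
    (p ++ a :: c :: q).idxOf i < (p ++ a :: c :: q).idxOf (i + 1) ↔
      (p ++ c :: a :: q).idxOf i < (p ++ c :: a :: q).idxOf (i + 1) := by
  have ha : a ∉ p := by
    intro h
    simp [List.nodup_append] at hn
    exact (hn.2.2 a h).1 rfl
  have hc : c ∉ p := by
    intro h
    simp [List.nodup_append] at hn
    exact (hn.2.2 c h).2.1 rfl
  have hlt : ∀ j ∈ p, p.idxOf j < p.length := fun j => List.idxOf_lt_length_of_mem
  have h1 := hlt i
  have h2 := hlt (i + 1)
  simp only [List.idxOf_append, List.idxOf_cons]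
  by_cases h3 : i ∈ p <;> by_cases h4 : i + 1 ∈ p <;> grind

theorem isLabeling_knuthMove_iff {s n : ℕ} {v w : List ℕ} {L : ℕ → ℕ} (h : KnuthMove v w)
    (hv : v.Nodup) : IsLabeling s n v L ↔ IsLabeling s n w L := by
  have key : ∀ i, v.idxOf i < v.idxOf (i + 1) ↔ w.idxOf i < w.idxOf (i + 1) := by
    cases h with
    | left p q a b c h h' =>
      have hn : (p ++ a :: c :: (b :: q)).Nodup := by simpa using hv
      have hab : a ≠ b := by
        rintro rfl
        simp [List.nodup_append] at hn
      simpa using idxOf_lt_succ_iff_swap (by omega) hn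
    | right p q a b c h h' =>
      have hn : ((p ++ [b]) ++ a :: c :: q).Nodup := by simpa using hv
      have hbc : b ≠ c := by
        rintro rfl
        simp [List.nodup_append] at hn
      simpa using idxOf_lt_succ_iff_swap (by omega) hn
  simp only [IsLabeling, key]

theorem antitone_zero_seq : Antitone (0 : ℕ → ℕ) := fun _ _ _ => le_rfl

/-- The witness letter `b` forces a strict label increase between `a` and `c`. An increase of at
least 2 is a far commutation; an increase of exactly 1 fixes the label of `b` and gives a Knuth move
on consecutive letters. -/
theorem boundedRun_knuthMove {lam : List ℕ} (hlam : Decreasing lam) {s n : ℕ} {v w : List ℕ}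
    {L : ℕ → ℕ} (h : KnuthMove v w) (hv : v.Perm (List.range' (s + 1) n))
    (hL : IsLabeling s n v L) :
    boundedRun lam (v.map L) 0 = boundedRun lam (w.map L) 0 := by
  have hn : v.Nodup := hv.nodup_iff.2 List.nodup_range'
  have hr : ∀ i ∈ v, s + 1 ≤ i ∧ i ≤ s + n := fun i hi => by
    have := hv.mem_iff.1 hi
    rw [List.mem_range'_1] at this
    omega
  cases h with
  | left p q a b c hab hbc =>
    have ha := hr a (by simp)
    have hb := hr b (by simp)
    have hc := hr c (by simp)
    have h1 := hL.mono ha.1 hab hb.2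
    have h2 : L b < L c := by
      refine hL.lt hb.1 hbc hc.2 ?_
      have hbp : b ∉ p := by
        intro h
        simp [List.nodup_append] at hn
        grind
      have hcp : c ∉ p := by
        intro h
        simp [List.nodup_append] at hn
        grind
      simp [List.idxOf_append, List.idxOf_cons, hbp, hcp]
      grind
    by_cases hfar : L a + 2 ≤ L c
    · simpa using boundedRun_localMove hlam _ (p.map L) _ _ (L b :: q.map L) 0 rfl
        antitone_zero_seq (.far (L a) (L c) hfar)
    · have e1 : L b = L a := by omega
      have e2 : L c = L a + 1 := by omega
      simpa [e1, e2] using boundedRun_localMove hlam _ (p.map L) _ _ (q.map L) 0 rfl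
        antitone_zero_seq (.knuthLeft (L a))
  | right p q a b c hab hbc =>
    have ha := hr a (by simp)
    have hb := hr b (by simp)
    have hc := hr c (by simp)
    have h1 := hL.mono hb.1 hbc hc.2
    have h2 : L a < L b := by
      refine hL.lt ha.1 hab hb.2 ?_
      have hap : a ∉ p := by
        intro h
        simp [List.nodup_append] at hn
        grind
      have hbp : b ∉ p := by
        intro h
        simp [List.nodup_append] at hn
        grind
      simp [List.idxOf_append, List.idxOf_cons, hap, hbp]
    by_cases hfar : L a + 2 ≤ L c
    · simpa using boundedRun_localMove hlam _ (p.map L ++ [L b]) _ _ (q.map L) 0 rfl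
        antitone_zero_seq (.far (L a) (L c) hfar)
    · have e1 : L b = L a + 1 := by omega
      have e2 : L c = L a + 1 := by omega
      simpa [e1, e2] using boundedRun_localMove hlam _ (p.map L) _ _ (q.map L) 0 rfl
        antitone_zero_seq (.knuthRight (L a))

/-- Both claims are proved together, since symmetry and transitivity require transporting the
labeling along the equivalence. -/
theorem boundedRun_knuthEquiv {lam : List ℕ} (hlam : Decreasing lam) {s n : ℕ} {v w : List ℕ}
    {L : ℕ → ℕ} (h : KnuthEquiv v w) (hv : v.Perm (List.range' (s + 1) n)) :
    (IsLabeling s n v L ↔ IsLabeling s n w L) ∧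
      (IsLabeling s n v L → boundedRun lam (v.map L) 0 = boundedRun lam (w.map L) 0) := by
  induction h with
  | rel _ _ h =>
    exact ⟨isLabeling_knuthMove_iff h (hv.nodup_iff.2 List.nodup_range'),
      boundedRun_knuthMove hlam h hv⟩
  | refl _ => exact ⟨Iff.rfl, fun _ => rfl⟩
  | symm x y h ih =>
    have := ih ((KnuthEquiv.perm h).trans hv)
    exact ⟨this.1.symm, fun h' => (this.2 (this.1.2 h')).symm⟩
  | trans x y z h h' ih ih' =>
    have h1 := ih hv
    have h2 := ih' ((KnuthEquiv.perm h).symm.trans hv)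
    exact ⟨h1.1.trans h2.1, fun h3 => (h1.2 h3).trans (h2.2 (h1.1.1 h3))⟩

/-! ### Removing a full first row -/

theorem boundedRun_rotate {lam : List ℕ} (hlam : Decreasing lam) {ν : ℕ → ℕ} (hν : Antitone ν)
    (R : List ℕ) (hR : ∀ a ∈ R, ¬ Insertable lam ν a) (Z : List ℕ) :
    boundedRun lam (Z ++ R) ν = boundedRun lam (R.map (· + 1) ++ Z) ν := by
  induction R using List.reverseRecOn generalizing Z with
  | nil => simp
  | append_singleton R a ih =>
    rw [← List.append_assoc, boundedRun_concat_of_not_insertable hlam hν _ (hR a (by simp)),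
      ← List.cons_append, ih (fun b hb => hR b (by simp [hb]))]
    simp

theorem antitone_single_zero (i : ℕ) : Antitone (Pi.single 0 i : ℕ → ℕ) := by
  refine antitone_nat_of_succ_le fun j => ?_
  simp [Pi.single_apply]

theorem boundedRun_fill {lam : List ℕ} (hlam : Decreasing lam) (Z : List ℕ) (j i : ℕ)
    (h : i + j ≤ lam.getD 0 0) :
    boundedRun lam (Z ++ List.replicate j 0) (Pi.single 0 i) =
      boundedRun lam Z (Pi.single 0 (i + j)) := by
  induction j generalizing i with
  | zero => simp
  | succ j ih =>
    have hi : Insertable lam (Pi.single 0 i) 0 :=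
      ⟨fun b hb => by omega, by simp only [Pi.single_eq_same]; omega⟩
    rw [List.replicate_succ', ← List.append_assoc,
      boundedRun_concat_of_insertable hlam (antitone_single_zero i) _ hi, ← Pi.single_add,
      ih _ (by omega)]
    congr 2
    omega

/-- The sequence `ν` with a new first entry `m`. -/
def consSeq (m : ℕ) (ν : ℕ → ℕ) : ℕ → ℕ
  | 0 => m
  | i + 1 => ν i

theorem antitone_consSeq {m : ℕ} {ν : ℕ → ℕ} (hν : Antitone ν) (hm : ν 0 ≤ m) :
    Antitone (consSeq m ν) := by
  refine antitone_nat_of_succ_le fun i => ?_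
  cases i with
  | zero => exact hm
  | succ i => exact hν (Nat.le_succ i)

theorem consSeq_add_single (m : ℕ) (ν : ℕ → ℕ) (a : ℕ) :
    consSeq m ν + Pi.single (a + 1) 1 = consSeq m (ν + Pi.single a 1) := by
  funext i
  rw [add_single_apply]
  cases i with
  | zero => simp [consSeq]
  | succ i =>
    simp only [consSeq, add_single_apply]
    simp

theorem consSeq_zero (m : ℕ) : consSeq m 0 = Pi.single 0 m := by
  funext i
  cases i <;> simp [consSeq]

theorem Decreasing.of_cons {m : ℕ} {lam : List ℕ} (h : Decreasing (m :: lam)) :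
    Decreasing lam := fun i j hij => by
  simpa using h (Nat.succ_le_succ hij)

theorem Decreasing.getD_le {m : ℕ} {lam : List ℕ} (h : Decreasing (m :: lam)) :
    lam.getD 0 0 ≤ m := by
  simpa using h (Nat.zero_le 1)

/-- The only new condition concerns `a = 0`, where row 1 must be shorter than row 0; it follows from
the bound `lam.getD 0 0 ≤ m`. -/
theorem insertable_consSeq_iff {m : ℕ} {lam : List ℕ} (hlam : Decreasing (m :: lam))
    {ν : ℕ → ℕ} {a : ℕ} :
    Insertable (m :: lam) (consSeq m ν) (a + 1) ↔ Insertable lam ν a := by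
  unfold Insertable
  rw [List.getD_cons_succ]
  refine and_congr_left fun h => ?_
  simp only [consSeq] at h ⊢
  constructor
  · rintro h' b rfl
    exact h' (b + 1) rfl
  · intro h' b hb
    obtain rfl : b = a := by omega
    cases b with
    | zero => exact h.trans_le hlam.getD_le
    | succ b => exact h' b rfl

theorem boundedRun_consSeq {m : ℕ} {lam : List ℕ} (hlam : Decreasing (m :: lam)) :
    ∀ (N : ℕ) (x : List ℕ) (ν : ℕ → ℕ), runMeasure lam.length x = N → Antitone ν → ν 0 ≤ m →
      boundedRun (m :: lam) (x.map (· + 1)) (consSeq m ν) = boundedRun lam x ν := by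
  intro N
  induction N using Nat.strong_induction_on with
  | _ N ih =>
    intro x ν hN hν hm
    by_cases hz : ∃ a ∈ x, lam.getD a 0 = 0
    · rw [boundedRun_eq_false _ _ _ rfl hz]
      obtain ⟨a, ha, ha0⟩ := hz
      exact boundedRun_eq_false _ _ _ rfl ⟨a + 1, List.mem_map.2 ⟨a, ha, rfl⟩, by simpa using ha0⟩
    rcases List.eq_nil_or_concat' x with rfl | ⟨y, a, rfl⟩
    · rw [List.map_nil, boundedRun_nil, boundedRun_nil]
    have ha : a < lam.length := lt_length_of_getD_ne_zero fun h => hz ⟨a, by simp, h⟩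
    rw [runMeasure_append, runMeasure_cons, runMeasure_nil] at hN
    rw [List.map_append, List.map_singleton]
    by_cases hi : Insertable lam ν a
    · rw [boundedRun_concat_of_insertable hlam.of_cons hν _ hi,
        boundedRun_concat_of_insertable hlam (antitone_consSeq hν hm) _
          ((insertable_consSeq_iff hlam).2 hi), consSeq_add_single]
      refine ih _ (by omega) y _ rfl (hi.antitone hν) ?_
      rw [add_single_apply]
      split_ifs with h
      · subst h
        exact (Nat.succ_le_of_lt hi.2).trans hlam.getD_le
      · exact hm
    · rw [boundedRun_concat_of_not_insertable hlam.of_cons hν _ hi,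
        boundedRun_concat_of_not_insertable hlam (antitone_consSeq hν hm) _
          (mt (insertable_consSeq_iff hlam).1 hi), ← List.map_cons (f := (· + 1))]
      refine ih _ ?_ _ _ rfl hν hm
      rw [runMeasure_cons]
      omega

theorem exists_eq_replicate_append {l : List ℕ} (hl : l.Pairwise (· ≤ ·)) :
    ∃ k R, l = List.replicate k 0 ++ R ∧ ∀ a ∈ R, 0 < a := by
  induction l with
  | nil => exact ⟨0, [], rfl, by simp⟩
  | cons b l ih =>
    rw [List.pairwise_cons] at hl
    rcases Nat.eq_zero_or_pos b with rfl | hb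
    · obtain ⟨k, R, rfl, hR⟩ := ih hl.2
      exact ⟨k + 1, R, rfl, hR⟩
    · refine ⟨0, b :: l, rfl, fun a ha => ?_⟩
      rcases List.mem_cons.1 ha with rfl | ha
      · exact hb
      · exact hb.trans_le (hl.1 a ha)

/-- `R` consists of some zeros followed by positive letters. The positive letters cannot enter the
empty partition and rotate; `m` zeros fill row 0; the surplus zeros rotate last, landing in front of
the others and so restoring the order of `R`. -/
theorem boundedRun_first_row {m : ℕ} {lam : List ℕ} (hlam : Decreasing (m :: lam)) (Z R : List ℕ)
    (hR : R.Pairwise (· ≤ ·)) :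
    boundedRun (m :: lam) (Z ++ (List.replicate m 0 ++ R)) 0 =
      boundedRun (m :: lam) (R.map (· + 1) ++ Z) (Pi.single 0 m) := by
  obtain ⟨k, R, rfl, hpos⟩ := exists_eq_replicate_append hR
  have e : Z ++ (List.replicate m 0 ++ (List.replicate k 0 ++ R)) =
      (Z ++ List.replicate k 0 ++ List.replicate m 0) ++ R := by
    simp only [List.append_assoc]
    rw [← List.append_assoc (List.replicate m 0), ← List.append_assoc (List.replicate k 0),
      List.replicate_append_replicate, List.replicate_append_replicate, add_comm]
  have h0 : (0 : ℕ → ℕ) = Pi.single 0 0 := by simp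
  rw [e, boundedRun_rotate hlam antitone_zero_seq R, ← List.append_assoc,
    ← List.append_assoc, h0, boundedRun_fill hlam _ m 0 (by simp), zero_add,
    boundedRun_rotate hlam (antitone_single_zero m)]
  · simp
  · intro a ha hi
    rw [List.eq_of_mem_replicate ha] at hi
    simpa using hi.2
  · intro a ha hi
    have := hi.1 (a - 1) (by have := hpos a ha; omega)
    simp at this

/-! ### Accepted words have enough zeros -/

/-- The size hypothesis forces `ν` to equal `lam` when the word is exhausted. Row 0 grows only by
consuming a letter 0, and a rejected letter returns as `a + 1 ≠ 0`. -/
theorem getD_zero_le_of_boundedRun {lam : List ℕ} (hlam : Decreasing lam) :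
    ∀ (N : ℕ) (x : List ℕ) (ν : ℕ → ℕ), runMeasure lam.length x = N → Antitone ν →
      (∀ i, ν i ≤ lam.getD i 0) →
      ∑ i ∈ Finset.range lam.length, ν i + x.length =
        ∑ i ∈ Finset.range lam.length, lam.getD i 0 →
      boundedRun lam x ν = true → lam.getD 0 0 ≤ ν 0 + x.count 0 := by
  intro N
  induction N using Nat.strong_induction_on with
  | _ N ih =>
    intro x ν hN hν hle hsum hrun
    have hz : ¬ ∃ a ∈ x, lam.getD a 0 = 0 := fun hz => by
      rw [boundedRun_eq_false _ _ _ rfl hz] at hrun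
      exact absurd hrun (by simp)
    rcases List.eq_nil_or_concat' x with rfl | ⟨y, a, rfl⟩
    · rw [List.count_nil, add_zero]
      rw [List.length_nil, add_zero] at hsum
      by_cases h0 : 0 < lam.length
      · have := (Finset.sum_eq_sum_iff_of_le fun i _ => hle i).1 hsum 0 (Finset.mem_range.2 h0)
        exact this.ge
      · rw [List.getD_eq_default _ _ (not_lt.mp h0)]
        exact Nat.zero_le _
    have ha : a < lam.length := lt_length_of_getD_ne_zero fun h => hz ⟨a, by simp, h⟩
    rw [runMeasure_append, runMeasure_cons, runMeasure_nil] at hN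
    rw [List.length_append, List.length_singleton] at hsum
    rw [List.count_append, List.count_singleton]
    by_cases hi : Insertable lam ν a
    · rw [boundedRun_concat_of_insertable hlam hν _ hi] at hrun
      have := ih _ (by omega) y _ rfl (hi.antitone hν) ?_ ?_ hrun
      · rw [add_single_apply] at this
        refine this.trans ?_
        by_cases h : a = 0
        · subst h
          simp
          omega
        · rw [if_neg (Ne.symm h)]
          omega
      · intro i
        rw [add_single_apply]
        split_ifs with h
        · subst h
          exact hi.2
        · exact hle i
      · simp only [add_single_apply, Finset.sum_add_distrib, Finset.sum_ite_eq', Finset.mem_range,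
          if_pos ha]
        omega
    · rw [boundedRun_concat_of_not_insertable hlam hν _ hi] at hrun
      have := ih _ ?_ _ _ rfl hν hle (by simpa using hsum) hrun
      · rw [List.count_cons_of_ne (by omega)] at this
        omega
      · rw [runMeasure_cons]
        omega

theorem sum_range_getD (lam : List ℕ) :
    ∑ i ∈ Finset.range lam.length, lam.getD i 0 = lam.sum := by
  induction lam with
  | nil => rfl
  | cons m lam ih =>
    rw [List.length_cons, Finset.sum_range_succ', List.sum_cons, ← ih, add_comm]
    simp

/-! ### Catabolism and the cocharge labeling -/

theorem idxOf_lt_idxOf_of_pairwise {l : List ℕ} (hl : l.Pairwise (· ≤ ·)) {i j : ℕ} (hij : i < j)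
    (hi : i ∈ l) (hj : j ∈ l) : l.idxOf i < l.idxOf j := by
  induction l with
  | nil => simp at hi
  | cons b l ih =>
    rw [List.pairwise_cons] at hl
    by_cases hbi : b = i
    · subst hbi
      rw [List.idxOf_cons_self, List.idxOf_cons_ne _ (by omega)]
      omega
    · have hi' : i ∈ l := (List.mem_cons.1 hi).resolve_left (Ne.symm hbi)
      have hbj : b ≠ j := fun h => by
        have := hl.1 i hi'
        omega
      rw [List.idxOf_cons_ne _ hbi, List.idxOf_cons_ne _ hbj]
      exact Nat.succ_lt_succ (ih hl.2 hi' ((List.mem_cons.1 hj).resolve_left (Ne.symm hbj)))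

/-- The labels after a catabolism. -/
def catabolismLabel (r : List ℕ) (L : ℕ → ℕ) (i : ℕ) : ℕ := if i ∈ r then L i else L i - 1

section
variable {s m n : ℕ} {z r : List ℕ} {L : ℕ → ℕ}

theorem perm_catabolism
    (hp : (z ++ (List.range' (s + 1) m ++ r)).Perm (List.range' (s + 1) (m + n))) :
    (r ++ z).Perm (List.range' (s + m + 1) n) := by
  rw [← List.range'_append_1] at hp
  have h : (List.range' (s + 1) m ++ (r ++ z)).Perm (z ++ (List.range' (s + 1) m ++ r)) := by
    rw [← List.append_assoc]
    exact List.perm_append_comm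
  have := (List.perm_append_left_iff _).1 (h.trans hp)
  rwa [show s + 1 + m = s + m + 1 by omega] at this

theorem mem_catabolism_iff
    (hp : (z ++ (List.range' (s + 1) m ++ r)).Perm (List.range' (s + 1) (m + n))) (i : ℕ) :
    i ∈ r ∨ i ∈ z ↔ s + m + 1 ≤ i ∧ i ≤ s + m + n := by
  have := (perm_catabolism hp).mem_iff (a := i)
  rw [List.mem_append, List.mem_range'_1] at this
  rw [this]
  omega

theorem not_mem_of_mem_right
    (hp : (z ++ (List.range' (s + 1) m ++ r)).Perm (List.range' (s + 1) (m + n))) {i : ℕ}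
    (hi : i ∈ r) : i ∉ z := fun hz =>
  List.disjoint_of_nodup_append ((perm_catabolism hp).nodup_iff.2 List.nodup_range') hi hz

theorem idxOf_initial
    (hp : (z ++ (List.range' (s + 1) m ++ r)).Perm (List.range' (s + 1) (m + n))) {i : ℕ}
    (h1 : s + 1 ≤ i) (h2 : i ≤ s + m) :
    (z ++ (List.range' (s + 1) m ++ r)).idxOf i =
      z.length + (List.range' (s + 1) m).idxOf i := by
  have hz : i ∉ z := fun h => by
    have := (mem_catabolism_iff hp i).1 (.inr h)
    omega
  have ht : i ∈ List.range' (s + 1) m := by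
    rw [List.mem_range'_1]
    omega
  rw [List.idxOf_append_of_notMem hz, List.idxOf_append_of_mem ht]

theorem label_initial_eq_zero
    (hp : (z ++ (List.range' (s + 1) m ++ r)).Perm (List.range' (s + 1) (m + n)))
    (hL : IsLabeling s (m + n) (z ++ (List.range' (s + 1) m ++ r)) L) {i : ℕ}
    (h1 : s + 1 ≤ i) (h2 : i ≤ s + m) : L i = 0 := by
  induction i, h1 using Nat.le_induction with
  | base => exact hL.1 (by omega)
  | succ i h1 ih =>
    rw [hL.2 i h1 (by omega), ih (by omega), if_pos]
    rw [idxOf_initial hp h1 (by omega), idxOf_initial hp (by omega) h2]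
    have := idxOf_lt_idxOf_of_pairwise (List.pairwise_le_range' 1 (s := s + 1) (n := m))
      (Nat.lt_add_one i) (by rw [List.mem_range'_1]; omega) (by rw [List.mem_range'_1]; omega)
    omega

/-- Such a letter exceeds `s + m` and stands to its left, so its label is strictly larger. -/
theorem label_pos_of_mem_left (hm : 0 < m)
    (hp : (z ++ (List.range' (s + 1) m ++ r)).Perm (List.range' (s + 1) (m + n)))
    (hL : IsLabeling s (m + n) (z ++ (List.range' (s + 1) m ++ r)) L) {i : ℕ}
    (hi : i ∈ z) : 0 < L i := by
  have h := (mem_catabolism_iff hp i).1 (.inr hi)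
  refine (Nat.zero_le _).trans_lt (hL.lt (i := s + m) (by omega) (by omega) (by omega) ?_)
  rw [idxOf_initial hp (by omega) le_rfl, List.idxOf_append_of_mem hi]
  have := List.idxOf_lt_length_of_mem hi
  omega

/-- Moving `r` in front of `z` alters the relative order of `i` and `i + 1` only when one lies in
`r` and the other in `z`; lowering the labels on `z` by 1 compensates exactly. Positivity on `z`
keeps the truncated subtraction honest. -/
theorem isLabeling_catabolism (hm : 0 < m) (hr : r.Pairwise (· ≤ ·))
    (hp : (z ++ (List.range' (s + 1) m ++ r)).Perm (List.range' (s + 1) (m + n)))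
    (hL : IsLabeling s (m + n) (z ++ (List.range' (s + 1) m ++ r)) L) :
    IsLabeling (s + m) n (r ++ z) (catabolismLabel r L) := by
  have hmem := mem_catabolism_iff hp
  have hnot : ∀ {i}, i ∈ r → i ∉ z := not_mem_of_mem_right hp
  have hidr : ∀ i ∈ r, (z ++ (List.range' (s + 1) m ++ r)).idxOf i =
      z.length + (m + r.idxOf i) := fun i hi => by
    have h := (hmem i).1 (.inl hi)
    rw [List.idxOf_append_of_notMem (hnot hi), List.idxOf_append_of_notMem, List.length_range']
    rw [List.mem_range'_1]
    omega
  have hidz : ∀ i ∈ z, (z ++ (List.range' (s + 1) m ++ r)).idxOf i = z.idxOf i := fun i hi =>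
    List.idxOf_append_of_mem hi
  have hltz : ∀ i ∈ z, z.idxOf i < z.length := fun i hi => List.idxOf_lt_length_of_mem hi
  have hltr : ∀ i ∈ r, r.idxOf i < r.length := fun i hi => List.idxOf_lt_length_of_mem hi
  have hidr' : ∀ i ∈ r, (r ++ z).idxOf i = r.idxOf i := fun i hi => List.idxOf_append_of_mem hi
  have hidz' : ∀ i ∈ z, (r ++ z).idxOf i = r.length + z.idxOf i := fun i hi =>
    List.idxOf_append_of_notMem fun h => hnot h hi
  have hpos : ∀ i ∈ z, 0 < L i := fun i hi => label_pos_of_mem_left hm hp hL hi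
  constructor
  · intro hn
    have hstep := hL.2 (s + m) (by omega) (by omega)
    rw [label_initial_eq_zero hp hL (by omega) le_rfl, zero_add] at hstep
    unfold catabolismLabel
    split_ifs with h
    · rw [hstep, if_pos]
      rw [hidr _ h, idxOf_initial hp (by omega) le_rfl]
      have := List.idxOf_lt_length_of_mem (a := s + m) (l := List.range' (s + 1) m)
        (by rw [List.mem_range'_1]; omega)
      rw [List.length_range'] at this
      omega
    · rw [hstep]
      split_ifs <;> rfl
  · intro i h1 h2
    have hi := (hmem i).2 ⟨by omega, by omega⟩
    have hi' := (hmem (i + 1)).2 ⟨by omega, by omega⟩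
    have hstep := hL.2 i (by omega) (by omega)
    unfold catabolismLabel
    by_cases hir : i ∈ r <;> by_cases hir' : i + 1 ∈ r
    · have := idxOf_lt_idxOf_of_pairwise hr (Nat.lt_add_one i) hir hir'
      rw [hidr _ hir, hidr _ hir', if_pos (by omega)] at hstep
      rw [hidr' _ hir, hidr' _ hir', if_pos hir, if_pos hir', if_pos (by omega), hstep]
    · have hz' := hi'.resolve_left hir'
      have := hltz _ hz'
      have := hltr _ hir
      rw [hidr _ hir, hidz _ hz', if_neg (by omega)] at hstep
      rw [hidr' _ hir, hidz' _ hz', if_pos hir, if_neg hir', if_pos (by omega), hstep]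
      rfl
    · have hz := hi.resolve_left hir
      have := hltz _ hz
      have := hltr _ hir'
      have := hpos _ hz
      rw [hidz _ hz, hidr _ hir', if_pos (by omega)] at hstep
      rw [hidz' _ hz, hidr' _ hir', if_neg hir, if_pos hir', if_neg (by omega), hstep]
      omega
    · have hz := hi.resolve_left hir
      have hz' := hi'.resolve_left hir'
      have := hpos _ hz
      rw [hidz _ hz, hidz _ hz'] at hstep
      rw [hidz' _ hz, hidz' _ hz', if_neg hir, if_neg hir', hstep]
      simp only [Nat.add_lt_add_iff_left]
      omega

theorem boundedRun_catabolism {lam : List ℕ} (hlam : Decreasing (m :: lam)) (hm : 0 < m)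
    (hr : r.Pairwise (· ≤ ·))
    (hp : (z ++ (List.range' (s + 1) m ++ r)).Perm (List.range' (s + 1) (m + n)))
    (hL : IsLabeling s (m + n) (z ++ (List.range' (s + 1) m ++ r)) L) :
    boundedRun (m :: lam) ((z ++ (List.range' (s + 1) m ++ r)).map L) 0 =
      boundedRun lam ((r ++ z).map (catabolismLabel r L)) 0 := by
  have hzero : (List.range' (s + 1) m).map L = List.replicate m 0 := by
    rw [List.eq_replicate_iff]
    refine ⟨by simp, fun b hb => ?_⟩
    obtain ⟨i, hi, rfl⟩ := List.mem_map.1 hb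
    rw [List.mem_range'_1] at hi
    exact label_initial_eq_zero hp hL (by omega) (by omega)
  have hsort : (r.map L).Pairwise (· ≤ ·) := by
    rw [List.pairwise_map]
    refine hr.imp_of_mem fun {i j} hi hj hij => ?_
    have h1 := (mem_catabolism_iff hp i).1 (.inl hi)
    have h2 := (mem_catabolism_iff hp j).1 (.inl hj)
    exact hL.mono (by omega) hij (by omega)
  have hshift : (r.map L).map (· + 1) ++ z.map L =
      ((r ++ z).map (catabolismLabel r L)).map (· + 1) := by
    rw [List.map_append, List.map_append, List.map_map, List.map_map, List.map_map]
    congr 1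
    · refine List.map_congr_left fun i hi => ?_
      simp [catabolismLabel, hi]
    · refine List.map_congr_left fun i hi => ?_
      have hir : i ∉ r := fun h => not_mem_of_mem_right hp h hi
      have := label_pos_of_mem_left hm hp hL hi
      simp only [catabolismLabel, Function.comp, if_neg hir]
      omega
  rw [List.map_append, List.map_append, hzero, boundedRun_first_row hlam _ _ hsort, hshift,
    ← consSeq_zero]
  exact boundedRun_consSeq hlam _ _ _ rfl antitone_zero_seq (Nat.zero_le _)

end

/-! ### The first row -/

theorem take_eq_range' {m s : ℕ} {l : List ℕ} (hl : l.Pairwise (· < ·)) (hs : ∀ x ∈ l, s ≤ x)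
    (hmem : ∀ i, s ≤ i → i < s + m → i ∈ l) : l.take m = List.range' s m := by
  induction m generalizing s l with
  | zero => simp
  | succ m ih =>
    have h0 := hmem s le_rfl (by omega)
    cases l with
    | nil => simp at h0
    | cons b l =>
      rw [List.pairwise_cons] at hl
      obtain rfl : b = s := by
        rcases List.mem_cons.1 h0 with h | h
        · exact h.symm
        · have h1 := hl.1 s h
          have h2 := hs b List.mem_cons_self
          omega
      rw [List.take_succ_cons, List.range'_succ, ih hl.2 (fun x hx => hl.1 x hx)]
      intro i h1 h2
      exact (List.mem_cons.1 (hmem i (by omega) (by omega))).resolve_left (by omega)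

/-- Sorting the remaining letters behind the first `m` gives a sorted permutation of the interval,
hence the interval itself. -/
theorem take_firstRow_eq {s m n : ℕ} {T : Tableau}
    (hT : (rowword T).Perm (List.range' (s + 1) (m + n))) (hr : (firstRow T).Pairwise (· ≤ ·))
    (h : FirstRowHasSmallest m T) : (firstRow T).take m = List.range' (s + 1) m := by
  set q := (firstRow T).drop m ++ rowword T.tail with hq
  have hperm : ((firstRow T).take m ++ q.mergeSort).Perm (List.range' (s + 1) (m + n)) := by
    refine List.Perm.trans ?_ hT
    refine ((List.mergeSort_perm q _).append_left _).trans ?_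
    rw [hq, ← List.append_assoc, List.take_append_drop, rowword_eq T]
    exact List.perm_append_comm
  have hsort : q.mergeSort.Pairwise (· ≤ ·) := by
    simpa using List.pairwise_mergeSort (le := fun a b : ℕ => decide (a ≤ b))
      (fun a b c => by simpa using fun h h' => le_trans h h')
      (fun a b => by simpa using le_total a b) q
  have hpw : ((firstRow T).take m ++ q.mergeSort).Pairwise (· ≤ ·) := by
    refine List.pairwise_append.2 ⟨hr.take, hsort, fun x hx y hy => h.2 x hx y ?_⟩
    exact (List.mergeSort_perm q _).mem_iff.1 hy
  have heq := hperm.eq_of_pairwise' hpw (List.pairwise_le_range' 1)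
  have hlen : ((firstRow T).take m).length = m := by
    rw [List.length_take]
    exact min_eq_left h.1
  have := congrArg (List.take m) heq
  rw [List.take_left' hlen, List.take_range'_of_length_ge (by omega)] at this
  exact this

theorem firstRowHasSmallest_of_boundedRun {s m : ℕ} {lam w : List ℕ} {L : ℕ → ℕ}
    (hlam : Decreasing (m :: lam)) (hm : 0 < m)
    (hT : (rowword (P w)).Perm (List.range' (s + 1) (m + lam.sum)))
    (hL : IsLabeling s (m + lam.sum) (rowword (P w)) L)
    (hrun : boundedRun (m :: lam) ((rowword (P w)).map L) 0 = true) :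
    FirstRowHasSmallest m (P w) := by
  have hnd : (rowword (P w)).Nodup := hT.nodup_iff.2 List.nodup_range'
  have hmem : ∀ i, i ∈ rowword (P w) ↔ s + 1 ≤ i ∧ i ≤ s + (m + lam.sum) := fun i => by
    rw [hT.mem_iff, List.mem_range'_1]
    omega
  have hcount : m ≤ ((rowword (P w)).map L).count 0 := by
    have := getD_zero_le_of_boundedRun hlam _ _ 0 rfl antitone_zero_seq
      (fun _ => Nat.zero_le _) ?_ hrun
    · simpa using this
    · rw [sum_range_getD, List.length_map, hT.length_eq, List.length_range', List.sum_cons]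
      simp
  -- Labels increase weakly, so a nonzero label here would leave at most `m - 1` zeros.
  have hLm : L (s + m) = 0 := by
    by_contra hne
    rw [(hT.map L).count_eq, show m + lam.sum = (m - 1) + (lam.sum + 1) by omega,
      ← List.range'_append_1, List.map_append, List.count_append, List.count_eq_zero_of_not_mem
      (l := (List.range' (s + 1 + (m - 1)) (lam.sum + 1)).map L)] at hcount
    · have := List.count_le_length (a := 0) (l := (List.range' (s + 1) (m - 1)).map L)
      simp only [List.length_map, List.length_range'] at this
      omega
    · intro h
      obtain ⟨i, hi, hi0⟩ := List.mem_map.1 h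
      rw [List.mem_range'_1] at hi
      have := hL.mono (i := s + m) (j := i) (by omega) (by omega) (by omega)
      omega
  have hord : ∀ i, s + 1 ≤ i → i + 1 ≤ s + m →
      (rowword (P w)).idxOf i < (rowword (P w)).idxOf (i + 1) := by
    intro i h1 h2
    by_contra hcon
    have h3 := hL.2 i h1 (by omega)
    rw [if_neg hcon] at h3
    have h4 := hL.mono (i := i + 1) (j := s + m) (by omega) h2 (by omega)
    omega
  have hsub : ∀ y ∈ firstRow (P w), y ∈ rowword (P w) := fun y hy => by
    rw [rowword_eq]
    exact List.mem_append_right _ hy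
  rw [rowword_eq] at hnd hord
  -- The minimum `s + 1` is the corner of the tableau. Each following letter stands to the right of
  -- its predecessor in the reading word, and the first row is read last.
  have hin : ∀ i, s + 1 ≤ i → i < s + 1 + m → i ∈ firstRow (P w) := by
    intro i h1
    induction i, h1 using Nat.le_induction with
    | base =>
      intro _
      have hs := (hmem (s + 1)).2 ⟨le_rfl, by omega⟩
      rcases P_eq_nil_or_head_le w with h | ⟨e, t, h, hle⟩
      · rw [h] at hs
        simp [rowword] at hs
      · have h2 := hle _ hs
        have h3 := ((hmem e).1 (hsub e (by simp [h]))).1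
        rw [h, show s + 1 = e by omega]
        exact List.mem_cons_self
    | succ i h1 ih =>
      intro h2
      have h3 := ih (by omega)
      have h4 := hord i h1 (by omega)
      have h5 := (hmem (i + 1)).2 ⟨by omega, by omega⟩
      rw [rowword_eq] at h5
      refine (List.mem_append.1 h5).resolve_left fun h6 => ?_
      rw [List.idxOf_append_of_notMem
        (fun h => List.disjoint_of_nodup_append hnd h h3), List.idxOf_append_of_mem h6] at h4
      have := List.idxOf_lt_length_of_mem h6
      omega
  have hrow : (firstRow (P w)).Pairwise (· < ·) := by
    have h1 := pairwise_firstRow_P w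
    have h2 : (firstRow (P w)).Pairwise (· ≠ ·) := (List.nodup_append'.1 hnd).2.1
    exact h1.imp₂ (fun _ _ h h' => lt_of_le_of_ne h h') h2
  have htake := take_eq_range' hrow (fun x hx => ((hmem x).1 (hsub x hx)).1) hin
  refine ⟨?_, fun x hx y hy => ?_⟩
  · have := congrArg List.length htake
    rw [List.length_take, List.length_range'] at this
    omega
  · have hy' : y ∉ (firstRow (P w)).take m := by
      intro h
      have hnd' := hnd
      rw [← List.take_append_drop m (firstRow (P w))] at hnd'
      have hnd'' : ((firstRow (P w)).take m ++
          ((firstRow (P w)).drop m ++ rowword (P w).tail)).Nodup := by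
        refine (List.Perm.nodup_iff ?_).1 hnd'
        rw [← List.append_assoc ((firstRow (P w)).take m)]
        exact List.perm_append_comm
      exact List.disjoint_of_nodup_append hnd'' h hy
    have hyw : y ∈ rowword (P w) := by
      rw [rowword_eq]
      rcases List.mem_append.1 hy with h | h
      · exact List.mem_append_right _ (List.mem_of_mem_drop h)
      · exact List.mem_append_left _ h
    have := (hmem y).1 hyw
    rw [htake, List.mem_range'_1] at hx hy'
    omega

/-! ### The main theorem -/

/-- The offset `s` is needed because a catabolism leaves a word on a shifted interval; `L` is any
function satisfying the labeling rules, so that `catabolismLabel` can take its place in the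
induction. -/
theorem boundedRun_iff_catabolizableList (lam : List ℕ) (hlam : Decreasing lam)
    (hpos : ∀ m ∈ lam, 0 < m) (s : ℕ) (w : List ℕ) (L : ℕ → ℕ)
    (hw : w.Perm (List.range' (s + 1) lam.sum)) (hL : IsLabeling s lam.sum w L) :
    boundedRun lam (w.map L) 0 = true ↔ CatabolizableList lam (P w) := by
  induction lam generalizing s w L with
  | nil =>
    obtain rfl : w = [] := by simpa using hw
    simp [boundedRun_nil, CatabolizableList, P]
  | cons m lam ih =>
    rw [List.forall_mem_cons] at hpos
    rw [List.sum_cons] at hw hL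
    have hk := knuthEquiv_rowword_P w
    have hinv := boundedRun_knuthEquiv hlam (L := L) hk hw
    have hT := hk.perm.symm.trans hw
    have hLT := hinv.1.1 hL
    rw [hinv.2 hL]
    simp only [CatabolizableList]
    refine ⟨fun hrun => ?_, fun h => ?_⟩
    -- The two directions differ only in how the first-row condition is obtained; after that, the
    -- induction hypothesis for the catabolism serves both.
    all_goals
      have hfirst : FirstRowHasSmallest m (P w) := by
        first
          | exact h.1
          | exact firstRowHasSmallest_of_boundedRun hlam hpos.1 hT hLT hrun
      have htake := take_firstRow_eq hT (pairwise_firstRow_P w) hfirst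
      have hword : rowword (P w) = rowword (P w).tail ++
          (List.range' (s + 1) m ++ (firstRow (P w)).drop m) := by
        rw [← htake, List.take_append_drop, ← rowword_eq]
      have hr := (pairwise_firstRow_P w).drop (i := m)
      rw [hword] at hT hLT
      have hstep := ih hlam.of_cons hpos.2 (s + m) _ _ (perm_catabolism hT)
        (isLabeling_catabolism hpos.1 hr hT hLT)
      rw [← boundedRun_catabolism hlam hpos.1 hr hT hLT, ← hword] at hstep
    · exact ⟨hfirst, hstep.1 hrun⟩
    · exact hstep.2 h.2

theorem isLabeling_cochargeLabel (n : ℕ) (w : List ℕ) :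
    IsLabeling 0 n w (cochargeLabel w) := by
  refine ⟨fun _ => rfl, fun i h1 _ => ?_⟩
  obtain ⟨i, rfl⟩ : ∃ j, i = j + 1 := ⟨i - 1, by omega⟩
  rw [cochargeLabel]
  split_ifs <;> rfl

theorem decreasing_of_pairwise {lam : List ℕ} (h : lam.Pairwise (· ≥ ·)) : Decreasing lam := by
  induction lam with
  | nil => exact fun i j _ => by simp
  | cons m lam ih =>
    rw [List.pairwise_cons] at h
    refine antitone_nat_of_succ_le fun i => ?_
    cases i with
    | zero =>
      cases lam with
      | nil => simp
      | cons k lam => simpa using h.1 k List.mem_cons_self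
    | succ i => simpa using ih h.2 (Nat.le_succ i)

end CatInsertion

theorem mainTheorem5 (n : ℕ) (u : List ℕ) (hu : CatInsertion.IsStandardWord n u)
    (lam : n.Partition) :
    CatInsertion.boundedCatabolismInsertion u lam = true ↔
      CatInsertion.IsCatabolizable lam (CatInsertion.P u) := by
  have hsum : (CatInsertion.partList lam).sum = n := by
    rw [← Multiset.sum_coe, CatInsertion.partList, Multiset.sort_eq, lam.parts_sum]
  refine CatInsertion.boundedRun_iff_catabolizableList _
    (CatInsertion.decreasing_of_pairwise (Multiset.pairwise_sort _ _)) (fun m hm => ?_) 0 u _ ?_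
    (CatInsertion.isLabeling_cochargeLabel _ u)
  · exact lam.parts_pos ((Multiset.mem_sort _).1 hm)
  · exact (congrArg (List.range' 1) hsum).symm ▸ hu
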